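/- Let $k$ be a field and let $A$ be a finite-dimensional associative unital $k$-algebra. Let $\operatorname{mod} A$ be the category of finitely generated left $A$-modules, let $\operatorname{ind} A$ be the set of isomorphism classes of indecomposable modules in $\operatorname{mod} A$, and let $\operatorname{brick} A$ be the set of isomorphism classes of bricks, i.e. of modules $X$ in $\operatorname{mod} A$ for which $\operatorname{End}_A(X)$ is a division ring. We call $A$ brick-finite if $\operatorname{brick} A$ is finite, and representation-finite if $\operatorname{ind} A$ is finite. A cycle in $\operatorname{mod} A$ is a sequence $X_0 \xrightarrow{f_1} X_1 \xrightarrow{f_2} \cdots \xrightarrow{f_t} X_t$ with $t \ge 1$, where all $X_i$ are indecomposable, all $f_i$ are non-zero and non-invertible $A$-homomorphisms, and $X_0 \cong X_t$. We call $A$ representation-directed if no indecomposable module in $\operatorname{mod} A$ lies on a cycle. A torsion pair in $\operatorname{mod} A$ is a pair $(\mathcal T, \mathcal F)$ of full subcategories of $\operatorname{mod} A$, closed under isomorphisms, such that: $\mathcal T$ and $\mathcal F$ have only $0$ in common; $\mathcal T$ is closed under quotients and $\mathcal F$ is closed under submodules; and each $M$ in $\operatorname{mod} A$ has a unique submodule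 $t(M)$ with $t(M) \in \mathcal T$ and $M/t(M) \in \mathcal F$. The first terms $\mathcal T$ of torsion pairs are called torsion classes; let $\operatorname{tors} A$ be the set of torsion classes, ordered by inclusion (it is a complete lattice). The length of $\operatorname{tors} A$ is the maximum of the lengths $r$ of finite chains $\mathcal T_0 \subsetneq \mathcal T_1 \subsetneq \cdots \subsetneq \mathcal T_r$ in $\operatorname{tors} A$, and it is infinite if there is no such maximum. Suppose that $A$ is brick-finite. Then $A$ is representation-directed if and only if $A$ is representation-finite and the length of $\operatorname{tors} A$ is equal to $|\operatorname{ind} A|$. -/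

import Mathlib

open CategoryTheory CategoryTheory.Limits

universe u v

namespace BrickTors

/-! Throughout, `A : Type v` is a ring, and `mod A` is the category of finitely generated left
`A`-modules, viewed as the full subcategory of `ModuleCat.{v} A` on the finitely generated modules.
As every finitely generated module is a quotient of some `Aⁿ`, the universe `v` contains a copy
of each of them. -/

section

variable (A : Type v) [Ring A]

/-- The indecomposable objects of `mod A`: finitely generated modules which are non-zero and are
not the direct sum of two non-zero modules. -/
def IsInd : ObjectProperty (ModuleCat.{v} A) :=
  fun M => Module.Finite A M ∧ Indecomposable M

/-- The bricks of `mod A`: finitely generated modules whose endomorphism ring is a division ring. -/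
def IsBrick : ObjectProperty (ModuleCat.{v} A) :=
  fun M => Module.Finite A M ∧
    Nontrivial (Module.End A M) ∧ ∀ f : Module.End A M, f ≠ 0 → IsUnit f

/-- The set of isomorphism classes of the modules that satisfy `P`. -/
def isoClasses (P : ObjectProperty (ModuleCat.{v} A)) :
    Set (Quotient (isIsomorphicSetoid (ModuleCat.{v} A))) :=
  {c | ∃ M : ModuleCat.{v} A, P M ∧ Quotient.mk _ M = c}

/-- `ind A`, the set of isomorphism classes of indecomposable modules in `mod A`. -/
def ind : Set (Quotient (isIsomorphicSetoid (ModuleCat.{v} A))) :=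
  isoClasses A (IsInd A)

/-- `brick A`, the set of isomorphism classes of bricks in `mod A`. -/
def brick : Set (Quotient (isIsomorphicSetoid (ModuleCat.{v} A))) :=
  isoClasses A (IsBrick A)

/-- `A` is representation-finite if `ind A` is finite. -/
def IsRepresentationFinite : Prop := (ind A).Finite

/-- `A` is brick-finite if `brick A` is finite. -/
def IsBrickFinite : Prop := (brick A).Finite

/-- A path `X 0 ⟶ X 1 ⟶ ⋯ ⟶ X t` in `mod A`, where `t` is a positive integer: all `X i` are
indecomposable objects of `mod A` and all the given morphisms are non-zero and non-invertible. -/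
structure ModPath where
  t : ℕ
  t_pos : 0 < t
  X : Fin (t + 1) → ModuleCat.{v} A
  ind_X : ∀ i, IsInd A (X i)
  f : ∀ i : Fin t, X i.castSucc ⟶ X i.succ
  f_ne_zero : ∀ i, f i ≠ 0
  f_not_isIso : ∀ i, ¬ IsIso (f i)

variable {A}

/-- A path is a cycle if its first and its last module are isomorphic. -/
def ModPath.IsCycle (p : ModPath A) : Prop :=
  Nonempty (p.X 0 ≅ p.X (Fin.last p.t))

/-- A module is directing if it does not lie, up to isomorphism, on any cycle in `mod A`. -/
def IsDirecting (M : ModuleCat.{v} A) : Prop :=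
  ¬ ∃ p : ModPath A, p.IsCycle ∧ ∃ i, Nonempty (M ≅ p.X i)

variable (A) in
/-- `A` is representation-directed if all indecomposable objects of `mod A` are directing. -/
def IsRepresentationDirected : Prop :=
  ∀ M : ModuleCat.{v} A, IsInd A M → IsDirecting M

/-- `(T, F)` is a torsion pair in `mod A`. Closure under quotients and under submodules includes
closure under isomorphisms. -/
structure IsTorsionPair (T F : ObjectProperty (ModuleCat.{v} A)) : Prop where
  finite_left : ∀ M, T M → Module.Finite A M
  finite_right : ∀ M, F M → Module.Finite A M
  /-- `T` and `F` have only `0` in common. -/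
  inter_eq_zero : ∀ M, T M ∧ F M ↔ IsZero M
  quotients : T.IsClosedUnderQuotients
  subobjects : F.IsClosedUnderSubobjects
  /-- Each `M` in `mod A` has a unique submodule in `T` with quotient in `F`. -/
  existsUnique_submodule : ∀ M : ModuleCat.{v} A, Module.Finite A M →
    ∃! N : Submodule A M, T (ModuleCat.of A N) ∧ F (ModuleCat.of A (M ⧸ N))

/-- `T` is a torsion class in `mod A` if it is the first term of a torsion pair. -/
def IsTorsionClass (T : ObjectProperty (ModuleCat.{v} A)) : Prop :=
  ∃ F : ObjectProperty (ModuleCat.{v} A), IsTorsionPair T F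

variable (A) in
/-- `tors A`, the set of torsion classes in `mod A`, partially ordered by inclusion. -/
abbrev Tors : Type (v + 1) :=
  {T : ObjectProperty (ModuleCat.{v} A) // IsTorsionClass T}

/-- The length of a partially ordered set: the maximum of the lengths `r` of its finite chains
`x₀ < x₁ < ⋯ < xᵣ`, and `∞` if there is no maximum. -/
noncomputable def latticeLength (L : Type*) [PartialOrder L] : WithBot ℕ∞ :=
  Order.krullDim L

end

end BrickTors

/-! Chains of torsion classes correspond to sequences of modules with homomorphisms in one direction
only. If `T i < T (i+1)`, a nonzero module of least length in `T (i+1)` and torsion-free for `T i`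
is a brick `B i`, and Hom(`B i`, `B j`) = 0 for `i < j` (`exists_bricks_of_ltSeries`). These bricks
are pairwise non-isomorphic, so chains have length at most |ind A|. If equality holds, they exhaust
ind A, and every nonzero non-isomorphism strictly lowers the index, which excludes cycles.
Conversely, in the directed case every indecomposable is a brick, so brick-finiteness gives
representation-finiteness. Nonzero maps generate a partial order on ind A; a linear extension orders
the indecomposables, and the left perpendiculars of the tails form a chain of length |ind A|
(`exists_ltSeries_of_ordering`). -/

namespace BrickTors

section

variable {A : Type v} [Ring A]

/-! ### Torsion pairs from perpendicular classes -/

section Perp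

/-- The modules in `mod A` without non-zero homomorphisms to the modules in `S`. -/
def leftPerp (S : ObjectProperty (ModuleCat.{v} A)) : ObjectProperty (ModuleCat.{v} A) :=
  fun X => Module.Finite A X ∧ ∀ Y, S Y → ∀ f : X ⟶ Y, f = 0

/-- The modules in `mod A` without non-zero homomorphisms from the modules in `S`. -/
def rightPerp (S : ObjectProperty (ModuleCat.{v} A)) : ObjectProperty (ModuleCat.{v} A) :=
  fun Y => Module.Finite A Y ∧ ∀ X, S X → ∀ f : X ⟶ Y, f = 0

lemma finite_of_epi {X Y : ModuleCat.{v} A} (f : X ⟶ Y) [Epi f] (h : Module.Finite A X) :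
    Module.Finite A Y :=
  Module.Finite.of_surjective f.hom ((ModuleCat.epi_iff_surjective f).1 inferInstance)

lemma finite_of_mono [IsNoetherianRing A] {X Y : ModuleCat.{v} A} (f : X ⟶ Y) [Mono f]
    (h : Module.Finite A Y) : Module.Finite A X :=
  Module.Finite.of_injective f.hom ((ModuleCat.mono_iff_injective f).1 inferInstance)

lemma linearMap_eq_zero_of_leftPerp {S : ObjectProperty (ModuleCat.{v} A)}
    {X : ModuleCat.{v} A} (hX : leftPerp S X) {Y : ModuleCat.{v} A} (hY : S Y) (f : X →ₗ[A] Y) :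
    f = 0 := by
  simpa using congrArg ModuleCat.Hom.hom (hX.2 Y hY (ModuleCat.ofHom f))

instance (S : ObjectProperty (ModuleCat.{v} A)) : (leftPerp S).IsClosedUnderQuotients where
  prop_of_epi f _ hX :=
    ⟨finite_of_epi f hX.1, fun Z hZ g => by
      rw [← cancel_epi f, hX.2 Z hZ (f ≫ g), comp_zero]⟩

lemma isClosedUnderSubobjects_rightPerp [IsNoetherianRing A]
    (S : ObjectProperty (ModuleCat.{v} A)) : (rightPerp S).IsClosedUnderSubobjects where
  prop_of_mono f _ hY :=
    ⟨finite_of_mono f hY.1, fun Z hZ g => by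
      rw [← cancel_mono f, hY.2 Z hZ (g ≫ f), zero_comp]⟩

/-- The largest submodule of `M` that lies in `leftPerp S`. -/
def perpRadical (S : ObjectProperty (ModuleCat.{v} A)) (M : ModuleCat.{v} A) : Submodule A M :=
  sSup {N : Submodule A M | leftPerp S (ModuleCat.of A N)}

lemma le_perpRadical {S : ObjectProperty (ModuleCat.{v} A)} {M : ModuleCat.{v} A}
    {N : Submodule A M} (hN : leftPerp S (ModuleCat.of A N)) : N ≤ perpRadical S M :=
  le_sSup hN

variable [IsNoetherianRing A]

/-- The kernel of a map to a member of `S` contains each submodule in the defining sum, hence the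
sum. -/
lemma leftPerp_perpRadical (S : ObjectProperty (ModuleCat.{v} A)) (M : ModuleCat.{v} A)
    [Module.Finite A M] : leftPerp S (ModuleCat.of A (perpRadical S M)) := by
  refine ⟨inferInstanceAs (Module.Finite A (perpRadical S M)), fun Y hY f => ?_⟩
  have key : perpRadical S M ≤ (LinearMap.ker f.hom).map (perpRadical S M).subtype := by
    refine sSup_le fun N hN => fun x hx => ?_
    refine ⟨⟨x, le_perpRadical hN hx⟩, ?_, rfl⟩
    have := linearMap_eq_zero_of_leftPerp hN hY
      (f.hom ∘ₗ Submodule.inclusion (le_perpRadical hN))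
    exact LinearMap.congr_fun this ⟨x, hx⟩
  ext x
  obtain ⟨y, hy, hxy⟩ := key x.2
  obtain rfl : y = x := Subtype.ext hxy
  simpa using hy

/-- The left perpendicular is closed under extensions, so the preimage in `M` of the image of `X`
already lies in the radical. -/
lemma rightPerp_quotient_perpRadical (S : ObjectProperty (ModuleCat.{v} A))
    (M : ModuleCat.{v} A) [Module.Finite A M] :
    rightPerp (leftPerp S) (ModuleCat.of A (M ⧸ perpRadical S M)) := by
  refine ⟨inferInstanceAs (Module.Finite A (M ⧸ perpRadical S M)), fun X hX g => ?_⟩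
  let R := perpRadical S M
  let q : M →ₗ[A] M ⧸ R := R.mkQ
  let g' : X →ₗ[A] M ⧸ R := g.hom
  have hle : (LinearMap.range g').comap q ≤ R := by
    refine le_perpRadical ⟨inferInstanceAs (Module.Finite A ((LinearMap.range g').comap q)),
      fun Y hY h => ?_⟩
    let h' : (LinearMap.range g').comap q →ₗ[A] Y := h.hom
    have hRle : R ≤ (LinearMap.range g').comap q := fun x hx => by
      have : q x = 0 := (Submodule.Quotient.mk_eq_zero R).2 hx
      rw [Submodule.mem_comap, this]
      exact zero_mem _
    have hzero : h' ∘ₗ Submodule.inclusion hRle = 0 :=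
      linearMap_eq_zero_of_leftPerp (leftPerp_perpRadical S M) hY _
    let p : (LinearMap.range g').comap q →ₗ[A] LinearMap.range g' :=
      q.restrict fun _ hx => hx
    have hp : Function.Surjective p := by
      rintro ⟨y, hy⟩
      obtain ⟨m, rfl⟩ := Submodule.mkQ_surjective R y
      exact ⟨⟨m, hy⟩, rfl⟩
    have hker : LinearMap.ker p ≤ LinearMap.ker h' := fun x hx => by
      have hx' : q x.1 = 0 := congrArg Subtype.val (LinearMap.mem_ker.1 hx)
      exact LinearMap.congr_fun hzero ⟨x.1, (Submodule.Quotient.mk_eq_zero R).1 hx'⟩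
    -- Since `h'` kills the radical, it factors through the image of `g'`; pulling back to `X` lets
    -- `hX` apply.
    let l : X →ₗ[A] Y := ((LinearMap.ker p).liftQ h' hker) ∘ₗ
      (p.quotKerEquivOfSurjective hp).symm.toLinearMap ∘ₗ g'.rangeRestrict
    have hl : l = 0 := linearMap_eq_zero_of_leftPerp hX hY l
    ext m
    obtain ⟨x, hx⟩ := m.2
    have hx' : g'.rangeRestrict x = p m := Subtype.ext hx
    have h1 : l x = h' m := by
      have : (p.quotKerEquivOfSurjective hp).symm (p m) = Submodule.Quotient.mk m := by
        rw [LinearEquiv.symm_apply_eq]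
        rfl
      simp only [l, LinearMap.comp_apply, hx', LinearEquiv.coe_coe, this]
      rfl
    have h2 : h' m = 0 := by rw [← h1, hl]; rfl
    exact h2
  refine ModuleCat.hom_ext (LinearMap.ext fun x => ?_)
  obtain ⟨m, hm⟩ := Submodule.mkQ_surjective R (g' x)
  have : m ∈ R := hle ⟨x, hm.symm⟩
  have h0 : g' x = 0 := by rw [← hm]; exact (Submodule.Quotient.mk_eq_zero R).2 this
  exact h0

lemma isTorsionPair_perp (S : ObjectProperty (ModuleCat.{v} A)) :
    IsTorsionPair (leftPerp S) (rightPerp (leftPerp S)) where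
  finite_left _ h := h.1
  finite_right _ h := h.1
  inter_eq_zero M := by
    refine ⟨fun h => (IsZero.iff_id_eq_zero M).2 (h.2.2 M h.1 _), fun h => ?_⟩
    have := ModuleCat.subsingleton_of_isZero h
    exact ⟨⟨inferInstance, fun _ _ f => h.eq_of_src f 0⟩,
      ⟨inferInstance, fun _ _ f => h.eq_of_tgt f 0⟩⟩
  quotients := inferInstance
  subobjects := isClosedUnderSubobjects_rightPerp _
  existsUnique_submodule M hM := by
    refine ⟨perpRadical S M, ⟨leftPerp_perpRadical S M, rightPerp_quotient_perpRadical S M⟩, ?_⟩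
    rintro N ⟨hN, hF⟩
    refine le_antisymm (le_perpRadical hN) fun x hx => ?_
    have := hF.2 _ (leftPerp_perpRadical S M)
      (ModuleCat.ofHom (N.mkQ ∘ₗ (perpRadical S M).subtype))
    have := LinearMap.congr_fun (congrArg ModuleCat.Hom.hom this) ⟨x, hx⟩
    exact (Submodule.Quotient.mk_eq_zero N).1 this

end Perp

/-! ### Bricks from chains of torsion classes -/

section TorsionPairs

variable {T F : ObjectProperty (ModuleCat.{v} A)}

lemma IsTorsionPair.prop_range (h : IsTorsionPair T F) {X Y : ModuleCat.{v} A} (hX : T X)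
    (f : X ⟶ Y) : T (ModuleCat.of A (LinearMap.range f.hom)) := by
  have := h.quotients
  have : Epi (ModuleCat.ofHom f.hom.rangeRestrict) :=
    (ModuleCat.epi_iff_surjective _).2 f.hom.surjective_rangeRestrict
  exact T.prop_of_epi (ModuleCat.ofHom f.hom.rangeRestrict) hX

lemma IsTorsionPair.prop_submodule (h : IsTorsionPair T F) {Y : ModuleCat.{v} A} (hY : F Y)
    (N : Submodule A Y) : F (ModuleCat.of A N) := by
  have := h.subobjects
  have : Mono (ModuleCat.ofHom N.subtype) :=
    (ModuleCat.mono_iff_injective _).2 N.injective_subtype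
  exact F.prop_of_mono (ModuleCat.ofHom N.subtype) hY

lemma IsTorsionPair.hom_eq_zero (h : IsTorsionPair T F) {X Y : ModuleCat.{v} A} (hX : T X)
    (hY : F Y) (f : X ⟶ Y) : f = 0 := by
  have hz := (h.inter_eq_zero _).1 ⟨h.prop_range hX f, h.prop_submodule hY (LinearMap.range f.hom)⟩
  have hs : Subsingleton (LinearMap.range f.hom) := ModuleCat.subsingleton_of_isZero hz
  have := LinearMap.range_eq_bot.1 ((Submodule.subsingleton_iff_eq_bot).1 hs)
  exact ModuleCat.hom_ext this

/-- For torsion classes `T` and `T'` with `T'` not contained in `T`, there is a non-zero module in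
`T'` that is torsion-free with respect to `T`. -/
lemma IsTorsionPair.exists_not_isZero {T' F' : ObjectProperty (ModuleCat.{v} A)}
    (h : IsTorsionPair T F) (h' : IsTorsionPair T' F') (hlt : ¬ T' ≤ T) :
    ∃ X, T' X ∧ F X ∧ ¬ IsZero X := by
  obtain ⟨M, hM', hM⟩ : ∃ M, T' M ∧ ¬ T M := by
    by_contra! hc
    exact hlt hc
  obtain ⟨N, ⟨hN, hQ⟩, -⟩ := h.existsUnique_submodule M (h'.finite_left M hM')
  have := h'.quotients
  have := h.quotients
  have : Epi (ModuleCat.ofHom N.mkQ) :=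
    (ModuleCat.epi_iff_surjective _).2 N.mkQ_surjective
  refine ⟨_, T'.prop_of_epi (ModuleCat.ofHom N.mkQ) hM', hQ, fun hz => hM ?_⟩
  have hs : Subsingleton (M ⧸ N) := ModuleCat.subsingleton_of_isZero hz
  rw [Submodule.Quotient.subsingleton_iff] at hs
  have : Epi (ModuleCat.ofHom N.subtype) :=
    (ModuleCat.epi_iff_surjective _).2 fun x => ⟨⟨x, hs ▸ Submodule.mem_top⟩, rfl⟩
  exact T.prop_of_epi (ModuleCat.ofHom N.subtype) hN

/-- A module of minimal length in the intersection of a class closed under quotients and a class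
closed under submodules is a brick. -/
lemma IsTorsionPair.exists_isBrick [IsArtinianRing A]
    {T' F' : ObjectProperty (ModuleCat.{v} A)} (h : IsTorsionPair T F)
    (h' : IsTorsionPair T' F') (hlt : ¬ T' ≤ T) : ∃ X, T' X ∧ F X ∧ IsBrick A X := by
  obtain ⟨X, ⟨hT, hF, hX⟩, hmin⟩ := exists_minimalFor_of_wellFoundedLT
    (fun X : ModuleCat.{v} A => T' X ∧ F X ∧ ¬ IsZero X) (fun X => Module.length A X)
    (h.exists_not_isZero h' hlt)
  have hfin : Module.Finite A X := h'.finite_left X hT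
  refine ⟨X, hT, hF, hfin, ?_, fun f hf => ?_⟩
  · have : Nontrivial X := by
      by_contra hn
      rw [not_nontrivial_iff_subsingleton] at hn
      exact hX (ModuleCat.isZero_of_subsingleton X)
    infer_instance
  -- A proper nonzero image would lie in both classes and be shorter than `X`.
  · have hr : LinearMap.range f = ⊤ := by
      by_contra hne
      refine (Submodule.length_lt hne).not_ge (hmin ⟨h'.prop_range hT (ModuleCat.ofHom f),
        h.prop_submodule hF (LinearMap.range f), fun hz => hf ?_⟩ (Submodule.length_lt hne).le)
      have hs : Subsingleton (LinearMap.range f) := ModuleCat.subsingleton_of_isZero hz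
      exact LinearMap.range_eq_bot.1 ((Submodule.subsingleton_iff_eq_bot).1 hs)
    rw [Module.End.isUnit_iff]
    exact IsNoetherian.bijective_of_surjective_endomorphism f (LinearMap.range_eq_top.1 hr)

/-- A chain of torsion classes gives a sequence of bricks that is orthogonal in one direction. -/
lemma exists_bricks_of_ltSeries [IsArtinianRing A] (s : LTSeries (Tors A)) :
    ∃ B : Fin s.length → ModuleCat.{v} A,
      (∀ i, IsBrick A (B i)) ∧ ∀ i j, i < j → ∀ f : B i ⟶ B j, f = 0 := by
  choose F hF using fun T : Tors A => T.2
  choose B hT hB hbrick using fun i : Fin s.length =>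
    (hF (s i.castSucc)).exists_isBrick (hF (s i.succ)) (s.step i).not_ge
  refine ⟨B, hbrick, fun i j hij f => (hF (s j.castSucc)).hom_eq_zero ?_ (hB j) f⟩
  -- `B i` lies in the upper class of step `i`, which is contained in the lower class of step `j`.
  exact s.monotone (Fin.succ_le_castSucc_iff.2 hij) _ (hT i)

end TorsionPairs

/-! ### Bricks are indecomposable; the upper bound on the length -/

section Bricks

lemma IsBrick.isIso {B : ModuleCat.{v} A} (hB : IsBrick A B) (f : B ⟶ B) (hf : f ≠ 0) :
    IsIso f := by
  rw [ConcreteCategory.isIso_iff_bijective]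
  exact (Module.End.isUnit_iff f.hom).1 (hB.2.2 f.hom fun h => hf (ModuleCat.hom_ext h))

lemma IsBrick.id_ne_zero {B : ModuleCat.{v} A} (hB : IsBrick A B) : 𝟙 B ≠ 0 := by
  have := hB.2.1
  exact fun h => one_ne_zero (α := Module.End A B) (congrArg ModuleCat.Hom.hom h)

/-- The idempotent projecting onto `Y` is zero or invertible, which forces `Y = 0` or `Z = 0`. -/
lemma IsBrick.isInd {B : ModuleCat.{v} A} (hB : IsBrick A B) : IsInd A B := by
  refine ⟨hB.1, fun hz => hB.id_ne_zero (hz.eq_of_src _ _), fun Y Z e => ?_⟩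
  by_cases hp : e.hom ≫ biprod.fst ≫ biprod.inl ≫ e.inv = 0
  · left
    rw [IsZero.iff_id_eq_zero]
    have : biprod.inl ≫ e.inv ≫ (e.hom ≫ biprod.fst ≫ biprod.inl ≫ e.inv) ≫ e.hom ≫ biprod.fst
        = 𝟙 Y := by simp
    rw [← this, hp]
    simp
  · right
    have := hB.isIso _ hp
    rw [IsZero.iff_id_eq_zero]
    have h0 : (e.hom ≫ biprod.fst ≫ biprod.inl ≫ e.inv) ≫ e.hom ≫ biprod.snd = 0 := by simp
    have h1 : e.hom ≫ (biprod.snd : Y ⊞ Z ⟶ Z) = 0 := by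
      rw [← cancel_epi (e.hom ≫ biprod.fst ≫ biprod.inl ≫ e.inv), h0, comp_zero]
    have h2 : biprod.inr ≫ e.inv ≫ e.hom ≫ (biprod.snd : Y ⊞ Z ⟶ Z) = 𝟙 Z := by simp
    rw [← h2, h1]
    simp

lemma mk_eq_mk_iff {M N : ModuleCat.{v} A} :
    (Quotient.mk (isIsomorphicSetoid (ModuleCat.{v} A)) M = Quotient.mk _ N) ↔
      Nonempty (M ≅ N) :=
  Quotient.eq

/-- The isomorphism classes of a family of bricks, as elements of `ind A`. -/
def indClass {ι : Type*} {B : ι → ModuleCat.{v} A} (hB : ∀ i, IsBrick A (B i)) (i : ι) : ind A :=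
  ⟨Quotient.mk _ (B i), B i, (hB i).isInd, rfl⟩

lemma indClass_injective {n : ℕ} {B : Fin n → ModuleCat.{v} A} (hB : ∀ i, IsBrick A (B i))
    (horth : ∀ i j, i < j → ∀ f : B i ⟶ B j, f = 0) : Function.Injective (indClass hB) := by
  have key : ∀ i j, i < j → indClass hB i ≠ indClass hB j := fun i j hij h => by
    obtain ⟨e⟩ := mk_eq_mk_iff.1 (congrArg Subtype.val h)
    refine (hB i).id_ne_zero ?_
    rw [← e.hom_inv_id, horth i j hij e.hom, zero_comp]
  intro i j h
  rcases lt_trichotomy i j with hij | hij | hij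
  · exact absurd h (key i j hij)
  · exact hij
  · exact absurd h.symm (key j i hij)

lemma krullDim_tors_le [IsArtinianRing A] (hfin : IsRepresentationFinite A) :
    latticeLength (Tors A) ≤ ((ind A).encard : WithBot ℕ∞) := by
  refine iSup_le fun s => ?_
  obtain ⟨B, hB, horth⟩ := exists_bricks_of_ltSeries s
  have : Finite (ind A) := hfin
  have hcard := Nat.card_le_card_of_injective _ (indClass_injective hB horth)
  rw [Nat.card_fin, Nat.card_coe_set_eq] at hcard
  rw [← hfin.cast_ncard_eq]
  exact_mod_cast hcard

end Bricks

/-! ### Directedness and orderings of the indecomposables -/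

section Directed

/-- If every indecomposable module is isomorphic to a member of a sequence of bricks that is
orthogonal in one direction, then there are no cycles. -/
lemma isRepresentationDirected_of_bricks {n : ℕ} {B : Fin n → ModuleCat.{v} A}
    (hB : ∀ i, IsBrick A (B i)) (horth : ∀ i j, i < j → ∀ f : B i ⟶ B j, f = 0)
    (hsurj : ∀ M, IsInd A M → ∃ i, Nonempty (M ≅ B i)) : IsRepresentationDirected A := by
  rintro M - ⟨p, ⟨e⟩, -⟩
  choose idx hidx using fun i => hsurj (p.X i) (p.ind_X i)
  have hanti : StrictAnti idx := by
    rw [Fin.strictAnti_iff_succ_lt]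
    intro i
    obtain ⟨e₁⟩ := hidx i.castSucc
    obtain ⟨e₂⟩ := hidx i.succ
    have hg : e₁.inv ≫ p.f i ≫ e₂.hom ≠ 0 := fun h => p.f_ne_zero i <| by
      rw [← cancel_epi e₁.inv, ← cancel_mono e₂.hom, Category.assoc, h]
      simp
    rcases lt_trichotomy (idx i.castSucc) (idx i.succ) with hlt | heq | hlt
    · exact absurd (horth _ _ hlt _) hg
    · exfalso
      generalize idx i.castSucc = a at *
      generalize idx i.succ = b at *
      subst heq
      have := (hB a).isIso _ hg
      have hf : p.f i = e₁.hom ≫ (e₁.inv ≫ p.f i ≫ e₂.hom) ≫ e₂.inv := by simp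
      refine p.f_not_isIso i ?_
      rw [hf]
      infer_instance
    · exact hlt
  have hlt : idx (Fin.last p.t) < idx 0 := hanti (Fin.lt_def.2 (by simpa using p.t_pos))
  obtain ⟨e₁⟩ := hidx 0
  obtain ⟨e₂⟩ := hidx (Fin.last p.t)
  have h0 := horth _ _ hlt (e₂.inv ≫ e.inv ≫ e₁.hom)
  refine (hB (idx 0)).id_ne_zero ?_
  have : 𝟙 (B (idx 0)) = e₁.inv ≫ e.hom ≫ e₂.hom ≫ (e₂.inv ≫ e.inv ≫ e₁.hom) := by simp
  rw [this, h0]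
  simp

/-- A nonzero non-invertible endomorphism is a cycle with one arrow. -/
lemma IsRepresentationDirected.isBrick (h : IsRepresentationDirected A) {M : ModuleCat.{v} A}
    (hM : IsInd A M) : IsBrick A M := by
  refine ⟨hM.1, ?_, fun f hf => ?_⟩
  · have : Nontrivial M := by
      by_contra hn
      rw [not_nontrivial_iff_subsingleton] at hn
      exact hM.2.1 (ModuleCat.isZero_of_subsingleton M)
    infer_instance
  · by_contra hu
    refine h M hM ⟨⟨1, one_pos, fun _ => M, fun _ => hM, fun _ => ModuleCat.ofHom f,
      fun _ h0 => hf ?_, fun _ hiso => hu ?_⟩, ⟨Iso.refl _⟩, 0, ⟨Iso.refl _⟩⟩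
    · simpa using congrArg ModuleCat.Hom.hom h0
    · rw [Module.End.isUnit_iff]
      exact (ConcreteCategory.isIso_iff_bijective (ModuleCat.ofHom f)).1 hiso

/-- There is a non-zero non-invertible homomorphism between the indecomposable modules. -/
def arrow (M N : ModuleCat.{v} A) : Prop :=
  IsInd A M ∧ IsInd A N ∧ ∃ f : M ⟶ N, f ≠ 0 ∧ ¬ IsIso f

lemma exists_relSeries_of_transGen {α : Type*} {r : α → α → Prop} {a b : α}
    (h : Relation.TransGen r a b) :
    ∃ p : RelSeries {x : α × α | r x.1 x.2}, p.head = a ∧ p.last = b ∧ 0 < p.length := by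
  induction h with
  | single h =>
    exact ⟨(RelSeries.singleton _ a).snoc _ (by simpa using h), by simp, by simp, by simp⟩
  | tail _ h ih =>
    obtain ⟨p, rfl, rfl, -⟩ := ih
    exact ⟨p.snoc _ h, by simp, by simp, by simp⟩

lemma IsRepresentationDirected.not_transGen_arrow (h : IsRepresentationDirected A)
    (M : ModuleCat.{v} A) : ¬ Relation.TransGen arrow M M := by
  intro hM
  obtain ⟨p, hp0, hp1, hpos⟩ := exists_relSeries_of_transGen hM
  have hstep : ∀ i : Fin p.length, arrow (p i.castSucc) (p i.succ) := p.step
  choose h1 h2 f hf0 hf1 using hstep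
  have hind : ∀ i, IsInd A (p i) := fun i => by
    rcases Fin.eq_castSucc_or_eq_last i with ⟨j, rfl⟩ | rfl
    · exact h1 j
    -- The last vertex starts no arrow, so it is treated as the target of the final one.
    · have := h2 ⟨p.length - 1, by omega⟩
      convert this
      ext
      simp
      omega
  refine h (p 0) (hind 0) ⟨⟨p.length, hpos, p, hind, f, hf0, hf1⟩, ?_, 0, ⟨Iso.refl _⟩⟩
  exact ⟨eqToIso (hp0.trans hp1.symm)⟩

/-- Over a representation-directed algebra of finite representation type, the indecomposable
modules can be ordered such that there are only homomorphisms in one direction. -/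
lemma IsRepresentationDirected.exists_ordering (h : IsRepresentationDirected A)
    (hfin : IsRepresentationFinite A) :
    ∃ M : Fin (ind A).ncard → ModuleCat.{v} A, (∀ i, IsInd A (M i)) ∧
      ∀ i j, i < j → ∀ f : M i ⟶ M j, f = 0 := by
  have : Finite (ind A) := hfin
  have := Fintype.ofFinite (ind A)
  choose rep hrep hmk using fun c : ind A => c.2
  let r : ind A → ind A → Prop := Relation.ReflTransGen fun c d => arrow (rep c) (rep d)
  have hr : IsPartialOrder (ind A) r :=
    { refl := fun _ => Relation.ReflTransGen.refl
      trans := fun _ _ _ => Relation.ReflTransGen.trans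
      antisymm := fun c d hcd hdc => by
        rcases Relation.reflTransGen_iff_eq_or_transGen.1 hcd with heq | htr
        · exact heq.symm
        · exact absurd ((htr.trans_left hdc).lift rep fun _ _ => id)
            (h.not_transGen_arrow (rep c)) }
  obtain ⟨s, hs, hrs⟩ := extend_partialOrder r
  let _ : LinearOrder (ind A) :=
    { le := s
      le_refl := hs.refl
      le_trans := hs.trans
      le_antisymm := hs.antisymm
      le_total := hs.total
      toDecidableLE := Classical.decRel _ }
  let e : Fin (ind A).ncard ≃o ind A := Fintype.orderIsoFinOfCardEq (ind A)
    (by rw [← Nat.card_eq_fintype_card, Nat.card_coe_set_eq])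
  -- The linear extension puts sources below targets, whereas the maps must go from larger to
  -- smaller index; hence the reversal.
  refine ⟨fun i => rep (e i.rev), fun i => hrep _, fun i j hij f => ?_⟩
  by_contra hf
  have hne : ¬ e i.rev ≤ e j.rev := by
    rw [e.le_iff_le, Fin.rev_le_rev]
    exact hij.not_ge
  refine hne (hrs _ _ (Relation.ReflTransGen.single ⟨hrep _, hrep _, f, hf, fun hiso => hne ?_⟩))
  have : (e i.rev).1 = (e j.rev).1 := by
    rw [← hmk, ← hmk (e j.rev)]
    exact mk_eq_mk_iff.2 ⟨asIso f⟩
  exact (Subtype.ext this).le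

/-- A sequence of `n` modules with homomorphisms in one direction only gives a chain of torsion
classes of length `n`. -/
lemma exists_ltSeries_of_ordering [IsNoetherianRing A] {n : ℕ} {M : Fin n → ModuleCat.{v} A}
    (hM : ∀ i, IsInd A (M i)) (horth : ∀ i j, i < j → ∀ f : M i ⟶ M j, f = 0) :
    ∃ s : LTSeries (Tors A), s.length = n := by
  -- Tails of the sequence, the last one empty. `M i` has no maps to the later modules, but its
  -- identity excludes it from the perpendicular of the tail starting at `i`.
  let S : Fin (n + 1) → ObjectProperty (ModuleCat.{v} A) :=
    fun i X => ∃ j : Fin n, i ≤ j.castSucc ∧ M j = X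
  refine ⟨⟨n, fun i => ⟨leftPerp (S i), _, isTorsionPair_perp (S i)⟩, fun i => ?_⟩, rfl⟩
  refine lt_of_le_not_ge (α := ObjectProperty (ModuleCat.{v} A)) (a := leftPerp (S i.castSucc))
    (b := leftPerp (S i.succ)) (fun X hX => ⟨hX.1, ?_⟩) fun hle => ?_
  · rintro Y ⟨j, hj, rfl⟩
    exact hX.2 _ ⟨j, (Fin.castSucc_lt_succ (i := i)).le.trans hj, rfl⟩
  · have hmem : leftPerp (S i.succ) (M i) := by
      refine ⟨(hM i).1, ?_⟩
      rintro Y ⟨j, hj, rfl⟩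
      exact horth i j (Fin.succ_le_castSucc_iff.1 hj)
    exact (hM i).2.1 ((IsZero.iff_id_eq_zero _).2 ((hle _ hmem).2 _ ⟨i, le_rfl, rfl⟩ _))

end Directed

end

end BrickTors


theorem corollary1p9 {k : Type u} {A : Type v} [Field k] [Ring A] [Algebra k A]
    [Module.Finite k A] (hA : BrickTors.IsBrickFinite A) :
    BrickTors.IsRepresentationDirected A ↔
      BrickTors.IsRepresentationFinite A ∧
        BrickTors.latticeLength (BrickTors.Tors A) =
          (((BrickTors.ind A).encard : ℕ∞) : WithBot ℕ∞) := by
  have : IsArtinianRing A := IsArtinianRing.of_finite k A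
  constructor
  · intro h
    have hfin : BrickTors.IsRepresentationFinite A := hA.subset <| by
      rintro _ ⟨M, hM, rfl⟩
      exact ⟨M, h.isBrick hM, rfl⟩
    refine ⟨hfin, le_antisymm (BrickTors.krullDim_tors_le hfin) ?_⟩
    obtain ⟨M, hM, horth⟩ := h.exists_ordering hfin
    rw [← hfin.cast_ncard_eq]
    exact Order.le_krullDim_iff.2 (BrickTors.exists_ltSeries_of_ordering hM horth)
  · rintro ⟨hfin, hlen⟩
    have : Finite (BrickTors.ind A) := hfin
    rw [← hfin.cast_ncard_eq] at hlen
    obtain ⟨s, hs⟩ := Order.le_krullDim_iff.1 hlen.ge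
    obtain ⟨B, hB, horth⟩ := BrickTors.exists_bricks_of_ltSeries s
    have hbij : Function.Bijective (BrickTors.indClass hB) :=
      (BrickTors.indClass_injective hB horth).bijective_of_nat_card_le
        (by rw [Nat.card_fin, Nat.card_coe_set_eq, hs])
    refine BrickTors.isRepresentationDirected_of_bricks hB horth fun M hM => ?_
    obtain ⟨i, hi⟩ := hbij.2 ⟨_, M, hM, rfl⟩
    exact ⟨i, BrickTors.mk_eq_mk_iff.1 (congrArg Subtype.val hi).symm⟩
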